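/- For a group $G$ and a positive integer $n$, let $B_n(G)$ be the set of all elements of $G$ having at most $n$ conjugates in $G$. For positive integers $k,n$ we say that $G$ satisfies the $(k,n)$-covering condition for commutators if there is a subset $S\subseteq G$ with $|S|\le k$ such that every commutator of $G$ lies in the product set $S\,B_n(G)=\{sb : s\in S,\ b\in B_n(G)\}$. Write $H'$ for the commutator subgroup of a group $H$. Theorem. There is a function $f:\mathbb{N}\times\mathbb{N}\to\mathbb{N}$ such that, for all positive integers $k,n$ and every (possibly infinite) group $G$ satisfying the $(k,n)$-covering condition for commutators, the group $G'$ has a characteristic subgroup $B$ for which the index $[G':B]$ and the order $|B'|$ are both finite and at most $f(k,n)$. -/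

import Mathlib

open scoped Pointwise

/-- `Bset n G` is the set of all elements of `G` having at most `n` conjugates in `G`
(`encard` is the cardinality in `ℕ∞`, so infinite conjugacy classes are excluded). -/
def Bset (n : ℕ) (G : Type*) [Group G] : Set G :=
  {x | (conjugatesOf x).encard ≤ n}

/-- The `(k, n)`-covering condition for commutators: some set `S` with `|S| ≤ k` is such that every
commutator of `G` lies in the product set `S * Bset n G`. -/
def CoveringCondition (k n : ℕ) (G : Type*) [Group G] : Prop :=
  ∃ S : Set G, S.encard ≤ k ∧ commutatorSet G ⊆ S * Bset n G

open scoped commutatorElement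

universe u

/-! ### Index and cardinality bounds. -/

section IndexBounds

variable {G : Type u} [Group G]

/-! Write B_m(X) for `Bset m X`. The aim is to cover G' itself by boundedly many translates of some
B_M(G'). Then, at a level M' where B_{M'}(G') = B_{M'^2}(G'), this set is a characteristic subgroup
of bounded index, and Neumann's BFC theorem bounds its derived subgroup
(`exists_characteristic_of_covering`).

To reach such a covering, first raise n to a level N at which every commutator in B_{N^2}(G) is in
B_N(G) (`exists_stable_level`). Let K be generated by G' ∩ B_N(G); by Schur's theorem G' meets
boundedly many cosets of K. Take a commutator a = [d,e] in B_N(G) with the largest K-orbit.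
Maximality gives a finite normal R and a normal U of finite index, both bounded, such that [K,u] ≤ R
whenever u ∈ U and ua is again a commutator in B_N(G) (`exists_absorbing_subgroups`).

Let Z be the centralizer of K modulo R. Perturbing d and e inside a subgroup V of bounded index
shows that V has bounded conjugacy classes modulo Z (`exists_subgroup_with_small_commutators`), so
[V,V] lies in boundedly many cosets of Z. Hence each element of G' is a product of boundedly many
commutators, one of boundedly many elements, and an element of Z. The commutators contribute
boundedly many translates of some B_m(G), and an element bz of G' with b ∈ B_m(G), z ∈ Z has few
G'-conjugates, because K moves z only within Rz (`mem_Bset_commutator_of_eq_mul`). -/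

theorem Subgroup.index_le_of_fiber {α : Type*} {L : Subgroup G} (f : G → α) {n : ℕ}
    (hf : (Set.range f).encard ≤ n) (h : ∀ x y, f x = f y → x⁻¹ * y ∈ L) :
    L.index ≠ 0 ∧ L.index ≤ n := by
  have hfin : (Set.range f).Finite := Set.finite_of_encard_le_coe hf
  have : Finite (Set.range f) := hfin
  let g : G ⧸ L → Set.range f := fun q => ⟨f q.out, q.out, rfl⟩
  have hg : Function.Injective g := by
    intro q q' hq
    have := h _ _ (Subtype.ext_iff.1 hq)
    rw [← QuotientGroup.out_eq' q, ← QuotientGroup.out_eq' q']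
    exact QuotientGroup.eq.2 this
  have hfq : Finite (G ⧸ L) := Finite.of_injective g hg
  refine ⟨Subgroup.index_ne_zero_of_finite, ?_⟩
  rw [Subgroup.index_eq_card]
  refine (Nat.card_le_card_of_injective g hg).trans ?_
  rw [Nat.card_coe_set_eq]
  exact_mod_cast (hfin.cast_ncard_eq).trans_le hf

theorem Subgroup.encard_univ_quotient_le {L : Subgroup G} {n : ℕ} (h0 : L.index ≠ 0)
    (hn : L.index ≤ n) : (Set.univ : Set (G ⧸ L)).encard ≤ n := by
  have : Finite (G ⧸ L) := Subgroup.index_ne_zero_iff_finite.1 h0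
  rw [Set.encard_univ, ENat.card_eq_coe_natCard]
  exact_mod_cast hn

theorem Subgroup.index_le_of_le_of_bound {L M : Subgroup G} {n : ℕ} (hLM : L ≤ M)
    (h : L.index ≠ 0 ∧ L.index ≤ n) : M.index ≠ 0 ∧ M.index ≤ n := by
  have hd := Subgroup.index_dvd_of_le hLM
  exact ⟨ne_zero_of_dvd_ne_zero h.1 hd, (Nat.le_of_dvd (Nat.pos_of_ne_zero h.1) hd).trans h.2⟩

theorem Subgroup.index_inf_bound {L M : Subgroup G} {m n : ℕ} (h : L.index ≠ 0 ∧ L.index ≤ m)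
    (h' : M.index ≠ 0 ∧ M.index ≤ n) : (L ⊓ M).index ≠ 0 ∧ (L ⊓ M).index ≤ m * n :=
  ⟨Subgroup.index_inf_ne_zero h.1 h'.1, Subgroup.index_inf_le.trans (Nat.mul_le_mul h.2 h'.2)⟩

theorem Subgroup.index_subgroupOf_bound {L : Subgroup G} {n : ℕ} (K : Subgroup G)
    (h : L.index ≠ 0 ∧ L.index ≤ n) :
    (L.subgroupOf K).index ≠ 0 ∧ (L.subgroupOf K).index ≤ n := by
  have h1 : L.relIndex K ≠ 0 := fun h0 => h.1 (Subgroup.index_eq_zero_of_relIndex_eq_zero h0)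
  refine ⟨h1, le_trans ?_ h.2⟩
  have := Subgroup.relIndex_le_of_le_right (H := L) (K := K) (L := ⊤) le_top
    (by rw [Subgroup.relIndex_top_right]; exact h.1)
  rwa [Subgroup.relIndex_top_right] at this

theorem Subgroup.index_map_bound {G' : Type*} [Group G'] {L : Subgroup G} {n : ℕ} {f : G →* G'}
    (hf : Function.Surjective f) (h : L.index ≠ 0 ∧ L.index ≤ n) :
    (L.map f).index ≠ 0 ∧ (L.map f).index ≤ n := by
  have hd := Subgroup.index_map_dvd L hf
  exact ⟨ne_zero_of_dvd_ne_zero h.1 hd, (Nat.le_of_dvd (Nat.pos_of_ne_zero h.1) hd).trans h.2⟩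

theorem Set.encard_image2_le {α β γ : Type*} (f : α → β → γ) {s : Set α} {t : Set β} {m n : ℕ}
    (hs : s.encard ≤ m) (ht : t.encard ≤ n) : (Set.image2 f s t).encard ≤ (m * n : ℕ) := by
  rw [← Set.image_prod]
  refine (Set.encard_image_le _ _).trans ?_
  rw [Set.encard_prod]
  push_cast
  exact mul_le_mul' hs ht

theorem Set.encard_mul_le {s t : Set G} {m n : ℕ}
    (hs : s.encard ≤ m) (ht : t.encard ≤ n) : (s * t).encard ≤ (m * n : ℕ) :=
  Set.encard_image2_le _ hs ht

theorem Set.encard_pow_le {s : Set G} {m : ℕ} (hs : s.encard ≤ m) (r : ℕ) :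
    (s ^ r).encard ≤ (m ^ r : ℕ) := by
  induction r with
  | zero => rw [pow_zero, ← Set.singleton_one, Set.encard_singleton]; simp
  | succ r ih =>
    rw [pow_succ, pow_succ]
    exact Set.encard_mul_le ih hs

theorem Subgroup.encard_coe_le_of_card_le {H : Subgroup G} {n : ℕ} [Finite H]
    (h : Nat.card H ≤ n) : (H : Set G).encard ≤ n := by
  rw [Set.encard]
  refine (ENat.card_eq_coe_natCard _).trans_le ?_
  exact_mod_cast h

theorem map_mem_commutator {G' : Type*} [Group G'] (f : G →* G') {g : G} (hg : g ∈ commutator G) :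
    f g ∈ commutator G' := by
  have h : f g ∈ (commutator G).map f := ⟨g, hg, rfl⟩
  rw [commutator_def, Subgroup.map_commutator] at h
  exact Subgroup.commutator_mono le_top le_top h

end IndexBounds

/-! ### Calculus of elements with few conjugates. -/

section Bset

variable {G : Type u} [Group G]

theorem mem_centralizer_of_conj_eq {a x y : G} (h : x * a * x⁻¹ = y * a * y⁻¹) :
    x⁻¹ * y ∈ Subgroup.centralizer {a} := by
  rw [Subgroup.mem_centralizer_singleton_iff]
  have : a = x⁻¹ * (y * a * y⁻¹) * x := by rw [← h]; group
  calc x⁻¹ * y * a = (x⁻¹ * (y * a * y⁻¹) * x) * (x⁻¹ * y) := by group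
    _ = a * (x⁻¹ * y) := by rw [← this]

theorem conj_eq_of_mem_centralizer {a x y : G} (h : x⁻¹ * y ∈ Subgroup.centralizer {a}) :
    x * a * x⁻¹ = y * a * y⁻¹ := by
  rw [Subgroup.mem_centralizer_singleton_iff] at h
  calc x * a * x⁻¹ = x * (a * (x⁻¹ * y)) * y⁻¹ := by group
    _ = y * a * y⁻¹ := by rw [← h]; group

theorem range_conj_eq_conjugatesOf (x : G) :
    Set.range (fun g : G => g * x * g⁻¹) = conjugatesOf x := by
  ext y
  simp [conjugatesOf, isConj_iff]

theorem mem_Bset_iff {n : ℕ} {x : G} : x ∈ Bset n G ↔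
    (Subgroup.centralizer {x}).index ≠ 0 ∧ (Subgroup.centralizer {x}).index ≤ n := by
  rw [Bset, Set.mem_ofPred_eq, ← range_conj_eq_conjugatesOf]
  constructor
  · intro h
    exact Subgroup.index_le_of_fiber _ h fun y z => mem_centralizer_of_conj_eq
  · rintro ⟨h0, hn⟩
    refine le_trans ?_ (Subgroup.encard_univ_quotient_le h0 hn)
    have : Set.range (fun g : G => g * x * g⁻¹) ⊆
        (fun q : G ⧸ Subgroup.centralizer {x} => q.out * x * q.out⁻¹) '' Set.univ := by
      rintro _ ⟨g, rfl⟩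
      refine ⟨(g : G ⧸ Subgroup.centralizer {x}), trivial, ?_⟩
      apply conj_eq_of_mem_centralizer
      rw [← QuotientGroup.eq, QuotientGroup.out_eq']
    exact (Set.encard_mono this).trans (Set.encard_image_le _ _)

theorem Bset_mono {m n : ℕ} (h : m ≤ n) : Bset m G ⊆ Bset n G := fun _ hx =>
  le_trans (Set.mem_ofPred_eq ▸ hx) (by exact_mod_cast h)

theorem one_mem_Bset {n : ℕ} (hn : 0 < n) : (1 : G) ∈ Bset n G := by
  rw [mem_Bset_iff]
  have : Subgroup.centralizer {(1 : G)} = ⊤ := by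
    ext; simp [Subgroup.mem_centralizer_singleton_iff]
  rw [this, Subgroup.index_top]
  exact ⟨one_ne_zero, hn⟩

theorem inv_mem_Bset {n : ℕ} {x : G} (hx : x ∈ Bset n G) : x⁻¹ ∈ Bset n G := by
  rw [mem_Bset_iff] at *
  refine Subgroup.index_le_of_le_of_bound ?_ hx
  intro g hg
  rw [Subgroup.mem_centralizer_singleton_iff] at *
  exact (Commute.inv_right (show Commute g x from hg)).eq

theorem mul_mem_Bset {m n : ℕ} {x y : G} (hx : x ∈ Bset m G) (hy : y ∈ Bset n G) :
    x * y ∈ Bset (m * n) G := by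
  rw [mem_Bset_iff] at *
  refine Subgroup.index_le_of_le_of_bound ?_ (Subgroup.index_inf_bound hx hy)
  rintro g ⟨hg, hg'⟩
  replace hg := Subgroup.mem_centralizer_singleton_iff.1 hg
  replace hg' := Subgroup.mem_centralizer_singleton_iff.1 hg'
  rw [Subgroup.mem_centralizer_singleton_iff]
  exact (Commute.mul_right (show Commute g x from hg) hg').eq

theorem conj_mem_Bset {n : ℕ} {x : G} (g : G) (hx : x ∈ Bset n G) : g * x * g⁻¹ ∈ Bset n G := by
  have : IsConj x (g * x * g⁻¹) := isConj_iff.2 ⟨g, rfl⟩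
  rw [Bset, Set.mem_ofPred_eq] at *
  rwa [← this.conjugatesOf_eq]

theorem mem_Bset_of_conj_mem {n : ℕ} {x : G} (g : G) (hx : g * x * g⁻¹ ∈ Bset n G) :
    x ∈ Bset n G := by
  have := conj_mem_Bset g⁻¹ hx
  convert this using 1
  group

theorem pow_subset_Bset {n : ℕ} {Y : Set G} (hY : Y ⊆ Bset n G) (r : ℕ) :
    Y ^ r ⊆ Bset (n ^ r) G := by
  induction r with
  | zero =>
    simp only [pow_zero, Set.one_subset]
    exact one_mem_Bset one_pos
  | succ r ih =>
    rw [pow_succ, pow_succ]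
    rintro _ ⟨x, hx, y, hy, rfl⟩
    exact mul_mem_Bset (ih hx) (hY hy)

theorem map_mem_Bset {n : ℕ} {G' : Type*} [Group G'] (f : G ≃* G') {x : G} (hx : x ∈ Bset n G) :
    f x ∈ Bset n G' := by
  rw [Bset, Set.mem_ofPred_eq] at *
  have : conjugatesOf (f x) ⊆ f '' conjugatesOf x := by
    intro y hy
    obtain ⟨c, rfl⟩ := isConj_iff.1 (show IsConj (f x) y from hy)
    exact ⟨f.symm c * x * (f.symm c)⁻¹, isConj_iff.2 ⟨_, rfl⟩, by simp⟩
  exact (Set.encard_mono this).trans ((Set.encard_image_le _ _).trans hx)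

theorem mem_Bset_subtype {n : ℕ} (K : Subgroup G) {x : K} (hx : (x : G) ∈ Bset n G) :
    x ∈ Bset n K := by
  rw [mem_Bset_iff] at *
  refine Subgroup.index_le_of_le_of_bound ?_ (Subgroup.index_subgroupOf_bound K hx)
  intro g hg
  rw [Subgroup.mem_subgroupOf, Subgroup.mem_centralizer_singleton_iff] at hg
  rw [Subgroup.mem_centralizer_singleton_iff]
  exact Subtype.ext hg

/-- A set covered by `k` translates of `B` is covered by `k` translates of `B⁻¹ * B` by elements
of its own. -/
theorem exists_subset_covering {X S B C : Set G} {k : ℕ} (hS : S.encard ≤ k)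
    (hX : X ⊆ S * B) (hBC : ∀ b ∈ B, ∀ c ∈ B, b⁻¹ * c ∈ C) :
    ∃ T ⊆ X, T.encard ≤ k ∧ ∀ x ∈ X, ∃ t ∈ T, t⁻¹ * x ∈ C := by
  classical
  let S' := {s ∈ S | ∃ b ∈ B, s * b ∈ X}
  choose! c hcB hcX using fun s (hs : s ∈ S') => hs.2
  refine ⟨(fun s => s * c s) '' S', ?_, ?_, ?_⟩
  · rintro _ ⟨s, hs, rfl⟩
    exact hcX s hs
  · exact (Set.encard_image_le _ _).trans ((Set.encard_mono (Set.sep_subset _ _)).trans hS)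
  · intro x hx
    obtain ⟨s, hs, b, hb, rfl⟩ := hX hx
    have hs' : s ∈ S' := ⟨hs, b, hb, hx⟩
    refine ⟨_, ⟨s, hs', rfl⟩, ?_⟩
    convert hBC _ (hcB s hs') _ hb using 1
    group

end Bset

/-! ### Representing cosets by short words. -/

section Growth

variable {G : Type u} [Group G]

/-- The images of the powers `Y ^ j` in `G ⧸ L` increase and have at most `N` points, so two
consecutive ones agree before step `N`. From then on the image is stable under left multiplication
by `Y`, hence contains the image of the whole closure. -/
theorem exists_mem_pow_inv_mul_mem (L : Subgroup G) {Y : Set G} (h1 : (1 : G) ∈ Y)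
    (hinv : ∀ y ∈ Y, y⁻¹ ∈ Y) {N : ℕ}
    (hN : ((fun g : G => (g : G ⧸ L)) '' (Subgroup.closure Y : Set G)).encard ≤ N)
    {g : G} (hg : g ∈ Subgroup.closure Y) : ∃ w ∈ Y ^ N, w⁻¹ * g ∈ L := by
  let A : ℕ → Set (G ⧸ L) := fun j => (fun g : G => (g : G ⧸ L)) '' (Y ^ j)
  have hpow : ∀ j, Y ^ j ⊆ (Subgroup.closure Y : Set G) := fun j =>
    Subgroup.pow_subset Subgroup.subset_closure
  have hsub : ∀ i j, i ≤ j → Y ^ i ⊆ Y ^ j := fun i j hij => Set.pow_subset_pow_right h1 hij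
  have hA : ∀ i j, i ≤ j → A i ⊆ A j := fun i j hij => Set.image_mono (hsub i j hij)
  have hAN : ∀ j, (A j).encard ≤ N := fun j =>
    (Set.encard_mono (Set.image_mono (hpow j))).trans hN
  have hgrow : ∀ j, (∃ i < j, A (i + 1) = A i) ∨ ((j + 1 : ℕ) : ℕ∞) ≤ (A j).encard := by
    intro j
    induction j with
    | zero =>
      right
      have : A 0 = {((1 : G) : G ⧸ L)} := by simp [A]
      rw [this, Set.encard_singleton]
      simp
    | succ j ih =>
      rcases ih with ⟨i, hi, h⟩ | ih
      · exact Or.inl ⟨i, by omega, h⟩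
      · by_cases h : A (j + 1) = A j
        · exact Or.inl ⟨j, by omega, h⟩
        · right
          have hlt : A j ⊂ A (j + 1) := lt_of_le_of_ne (hA _ _ (by omega)) (Ne.symm h)
          have hfin : (A j).Finite := Set.finite_of_encard_le_coe (hAN j)
          have := hfin.encard_lt_encard hlt
          have h2 := Order.add_one_le_of_lt (ih.trans_lt this)
          exact_mod_cast h2
  obtain ⟨i, hi, hstab⟩ : ∃ i < N, A (i + 1) = A i := by
    rcases hgrow N with h | h
    · exact h
    · have := h.trans (hAN N)
      have : N + 1 ≤ N := by exact_mod_cast this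
      omega
  have hstep : ∀ y ∈ Y, ∀ x : G, (x : G ⧸ L) ∈ A i → ((y * x : G) : G ⧸ L) ∈ A i := by
    rintro y hy x ⟨w, hw, hwx⟩
    rw [← hstab]
    refine ⟨y * w, ?_, ?_⟩
    · rw [pow_succ']
      exact Set.mul_mem_mul hy hw
    · have := QuotientGroup.eq.1 hwx
      refine QuotientGroup.eq.2 ?_
      convert this using 1
      group
  have key : (g : G ⧸ L) ∈ A i := by
    induction hg using Subgroup.closure_induction_left with
    | one => exact ⟨1, Set.one_mem_pow h1, rfl⟩
    | mul_left x hx y hy ih => exact hstep x hx y ih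
    | inv_mul_cancel x hx y hy ih => exact hstep _ (hinv x hx) y ih
  obtain ⟨w, hw, hwg⟩ := key
  exact ⟨w, hsub i N hi.le hw, QuotientGroup.eq.1 hwg⟩

end Growth

/-! ### Quantitative forms of Schur's theorem. -/

section Schur

/-- A monotone bound for the order of the commutator subgroup in terms of the number of
commutators. -/
def schurBound (m : ℕ) : ℕ := (Finset.range (m + 1)).sup Subgroup.cardCommutatorBound

theorem card_commutator_le_schurBound {G : Type u} [Group G] {m : ℕ}
    (h : (commutatorSet G).encard ≤ m) :
    Finite (commutator G) ∧ Nat.card (commutator G) ≤ schurBound m := by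
  have hfin : (commutatorSet G).Finite := Set.finite_of_encard_le_coe h
  have : Finite (commutatorSet G) := hfin
  refine ⟨inferInstance, (Subgroup.card_commutator_le_of_finite_commutatorSet G).trans ?_⟩
  refine Finset.le_sup (f := Subgroup.cardCommutatorBound) ?_
  rw [Finset.mem_range, Nat.lt_succ_iff, Nat.card_coe_set_eq]
  exact_mod_cast (hfin.cast_ncard_eq).trans_le h

/-- Modulo `R` a commutator depends only on the cosets of its entries modulo `U`, which leaves at
most `p * p * q` commutators. -/
theorem card_commutator_le_of_commutator_mem {G : Type u} [Group G] {p q : ℕ}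
    {U R : Subgroup G} [R.Normal] (hU : U.index ≠ 0 ∧ U.index ≤ p)
    (hR : (R : Set G).encard ≤ q) (hUR : ∀ u ∈ U, ∀ g : G, ⁅g, u⁆ ∈ R) :
    Finite (commutator G) ∧ Nat.card (commutator G) ≤ schurBound (p * p * q) := by
  apply card_commutator_le_schurBound
  have hq := Subgroup.encard_univ_quotient_le hU.1 hU.2
  refine le_trans (Set.encard_mono ?_) (Set.encard_mul_le
    (Set.encard_image2_le (fun a b : G ⧸ U => ⁅a.out, b.out⁆) hq hq) hR)
  rintro _ ⟨x, y, rfl⟩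
  refine ⟨_, ⟨(x : G ⧸ U), trivial, (y : G ⧸ U), trivial, rfl⟩, _, ?_, mul_inv_cancel_left _ _⟩
  obtain ⟨u, hu⟩ := QuotientGroup.mk_out_eq_mul U x
  obtain ⟨v, hv⟩ := QuotientGroup.mk_out_eq_mul U y
  change ⁅(x : G ⧸ U).out, (y : G ⧸ U).out⁆⁻¹ * ⁅x, y⁆ ∈ R
  generalize (x : G ⧸ U).out = x' at *
  generalize (y : G ⧸ U).out = y' at *
  have hx : x = x' * (u⁻¹ : U) := by rw [hu]; simp
  have hy : y = y' * (v⁻¹ : U) := by rw [hv]; simp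
  rw [hx, hy, commutatorElement_mul_left_eq_conj_mul, commutatorElement_mul_right_eq_mul_conj x']
  have h1 : ⁅((u⁻¹ : U) : G), y' * (v⁻¹ : U)⁆ ∈ R := by
    rw [← commutatorElement_inv]
    exact R.inv_mem (hUR _ (u⁻¹).2 _)
  have h2 : ⁅x', ((v⁻¹ : U) : G)⁆ ∈ R := hUR _ (v⁻¹).2 _
  have h3 := (inferInstance : R.Normal).conj_mem _
    ((inferInstance : R.Normal).conj_mem _ h1 x') ⁅x', y'⁆⁻¹
  have h4 := (inferInstance : R.Normal).conj_mem _ h2 y'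
  convert R.mul_mem h3 h4 using 1
  group

theorem Subgroup.closure_normal_of_conj_mem {G : Type u} [Group G] {E : Set G}
    (hE : ∀ x ∈ E, ∀ g : G, g * x * g⁻¹ ∈ E) : (Subgroup.closure E).Normal := by
  refine ⟨fun x hx g => ?_⟩
  induction hx using Subgroup.closure_induction with
  | mem x hx => exact Subgroup.subset_closure (hE x hx g)
  | one => simp
  | mul x y _ _ hx hy =>
    convert Subgroup.mul_mem _ hx hy using 1
    group
  | inv x _ hx =>
    convert Subgroup.inv_mem _ hx using 1
    group

theorem Subgroup.index_centralizer_closure_le {G : Type u} [Group G] {p : ℕ} {E : Set G}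
    (hE : E.encard ≤ p) (hconj : ∀ x ∈ E, ∀ g : G, g * x * g⁻¹ ∈ E) :
    (Subgroup.centralizer (Subgroup.closure E : Set G)).index ≠ 0 ∧
      (Subgroup.centralizer (Subgroup.closure E : Set G)).index ≤ (p + 1) ^ p := by
  have hfin : E.Finite := Set.finite_of_encard_le_coe hE
  have : Finite E := hfin
  have hcard : Nat.card E ≤ p := by
    rw [Nat.card_coe_set_eq]
    exact_mod_cast (hfin.cast_ncard_eq).trans_le hE
  refine Subgroup.index_le_of_fiber
    (fun g => (fun x => ⟨g * x * g⁻¹, hconj x x.2 g⟩ : E → E)) ?_ ?_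
  · refine (Set.encard_mono (Set.subset_univ _)).trans ?_
    rw [Set.encard_univ, ENat.card_eq_coe_natCard, Nat.card_fun]
    -- The base is `p + 1` because monotonicity in the exponent needs a positive base.
    have : Nat.card E ^ Nat.card E ≤ (p + 1) ^ p :=
      (Nat.pow_le_pow_left (by omega) _).trans (Nat.pow_le_pow_right (by omega) hcard)
    exact_mod_cast this
  · intro x y hxy
    rw [Subgroup.centralizer_closure, Subgroup.mem_centralizer_iff]
    intro a ha
    have h := Subtype.ext_iff.1 (congrFun hxy ⟨a, ha⟩)
    exact (Subgroup.mem_centralizer_singleton_iff.1 (mem_centralizer_of_conj_eq h)).symm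

theorem Subgroup.encard_commutator_closure_le {G : Type u} [Group G] {p : ℕ} {E : Set G}
    (hE : E.encard ≤ p) (hconj : ∀ x ∈ E, ∀ g : G, g * x * g⁻¹ ∈ E) :
    ((⁅Subgroup.closure E, Subgroup.closure E⁆ : Subgroup G) : Set G).encard ≤
      schurBound ((p + 1) ^ p * (p + 1) ^ p * 1) := by
  set T := Subgroup.closure E
  have hidx := Subgroup.index_subgroupOf_bound T (Subgroup.index_centralizer_closure_le hE hconj)
  obtain ⟨hfin, hle⟩ := card_commutator_le_of_commutator_mem (R := (⊥ : Subgroup T)) (q := 1) hidx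
    (by rw [Subgroup.coe_bot, Set.encard_singleton]; simp) (by
      intro u hu g
      rw [Subgroup.mem_bot, commutatorElement_eq_one_iff_mul_comm]
      exact Subtype.ext (Subgroup.mem_centralizer_iff.1 (Subgroup.mem_subgroupOf.1 hu) g g.2))
  rw [← Subgroup.map_subtype_commutator, Subgroup.coe_map]
  exact (Set.encard_image_le _ _).trans (Subgroup.encard_coe_le_of_card_le hle)

end Schur

/-! ### Absorption by a maximal orbit, and Neumann's theorem. -/

section Absorption

theorem encard_conjugatesOfSet_le {G : Type u} [Group G] {F : Set G} {m n : ℕ}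
    (hF : F.encard ≤ m) (hn : F ⊆ Bset n G) :
    (Group.conjugatesOfSet F).encard ≤ (m * n : ℕ) := by
  classical
  have hfin : F.Finite := Set.finite_of_encard_le_coe hF
  have hx : ∀ x ∈ F, (conjugatesOf x).Finite := fun x hx => Set.finite_of_encard_le_coe (hn hx)
  have hcard : hfin.toFinset.card ≤ m := by
    have := hfin.encard_eq_coe_toFinset_card ▸ hF
    exact_mod_cast this
  let c : G → Finset G := fun x => if h : (conjugatesOf x).Finite then h.toFinset else ∅
  have hc : ∀ x ∈ hfin.toFinset, (c x).card ≤ n := by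
    intro x hxF
    have hxF' := hfin.mem_toFinset.1 hxF
    have h1 : (conjugatesOf x).encard ≤ n := hn hxF'
    simp only [c, dif_pos (hx x hxF')]
    rw [(hx x hxF').encard_eq_coe_toFinset_card] at h1
    exact_mod_cast h1
  have hsub : Group.conjugatesOfSet F ⊆ (hfin.toFinset.biUnion c : Finset G) := by
    intro y hy
    obtain ⟨x, hxF, hxy⟩ := Group.mem_conjugatesOfSet_iff.1 hy
    rw [Finset.mem_coe, Finset.mem_biUnion]
    refine ⟨x, hfin.mem_toFinset.2 hxF, ?_⟩
    simp only [c, dif_pos (hx x hxF)]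
    exact (hx x hxF).mem_toFinset.2 hxy
  refine (Set.encard_mono hsub).trans ?_
  rw [Set.encard_coe_eq_coe_finsetCard]
  have := (Finset.card_biUnion_le_card_mul _ c n hc).trans (Nat.mul_le_mul_right n hcard)
  exact_mod_cast this

/-- The orbit of `a` under conjugation by the elements of `K`. -/
def conjOrbit {G : Type u} [Group G] (K : Subgroup G) (a : G) : Set G :=
  (fun k => k * a * k⁻¹) '' (K : Set G)

theorem conjOrbit_subset_conjugatesOf {G : Type u} [Group G] (K : Subgroup G) (a : G) :
    conjOrbit K a ⊆ conjugatesOf a := by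
  rintro _ ⟨k, -, rfl⟩
  exact isConj_iff.2 ⟨k, rfl⟩

/-- The `K`-orbit of `a`, with `K` the closure of `Y`, is reached by conjugators `w` of length `N`
in `Y`, which have few conjugates. Let T be the normal closure of `a` and these `w`; take U = C_G(T)
and R = T'. For u ∈ U each `w` commutes with u, so u times the orbit of `a` lies in the orbit of `u
* a`. The size hypothesis forces equality, which expresses [k,u] through commutators of T. -/
theorem exists_absorbing_subgroups (N : ℕ) : ∃ b c : ℕ, ∀ (G : Type u) [Group G] (Y : Set G),
    1 ∈ Y → (∀ y ∈ Y, y⁻¹ ∈ Y) → Y ⊆ Bset N G → ∀ a ∈ Bset N G,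
    ∃ R U : Subgroup G, R.Normal ∧ U.Normal ∧ (R : Set G).encard ≤ b ∧
      (U.index ≠ 0 ∧ U.index ≤ c) ∧
      ∀ u ∈ U, (conjOrbit (Subgroup.closure Y) (u * a)).encard ≤
        (conjOrbit (Subgroup.closure Y) a).encard →
        ∀ k ∈ Subgroup.closure Y, ⁅k, u⁆ ∈ R := by
  -- At most `N + 1` generators (`a` and one `w` per orbit point), each with at most `N` or `N ^ N`
  -- conjugates.
  let p := (N + 1) * (N + N ^ N)
  refine ⟨schurBound ((p + 1) ^ p * (p + 1) ^ p * 1), (p + 1) ^ p, ?_⟩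
  intro G _ Y h1 hinv hYB a ha
  set K := Subgroup.closure Y
  set O := conjOrbit K a
  have hO : O.encard ≤ N := (Set.encard_mono (conjOrbit_subset_conjugatesOf K a)).trans ha
  have hrep : ∀ o ∈ O, ∃ w ∈ Y ^ N, w * a * w⁻¹ = o := by
    rintro _ ⟨k, hk, rfl⟩
    have hi := mem_Bset_iff.1 ha
    obtain ⟨w, hw, hwk⟩ := exists_mem_pow_inv_mul_mem (Subgroup.centralizer {a}) h1 hinv
      ((Set.encard_mono (Set.subset_univ _)).trans
        (Subgroup.encard_univ_quotient_le hi.1 hi.2)) hk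
    exact ⟨w, hw, conj_eq_of_mem_centralizer hwk⟩
  choose! w hwY hwa using hrep
  have hwK : ∀ o ∈ O, w o ∈ K := by
    intro o ho
    have : Y ^ N ⊆ (K : Set G) := Subgroup.pow_subset Subgroup.subset_closure
    exact this (hwY o ho)
  let F : Set G := insert a (w '' O)
  let E := Group.conjugatesOfSet F
  have hF : F.encard ≤ (N + 1 : ℕ) := by
    refine (Set.encard_insert_le _ _).trans ?_
    push_cast
    exact add_le_add_left ((Set.encard_image_le _ _).trans hO) 1
  have hFB : F ⊆ Bset (N + N ^ N) G := by
    rintro x (rfl | ⟨o, ho, rfl⟩)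
    · exact Bset_mono (by omega) ha
    · exact Bset_mono (by omega) (pow_subset_Bset hYB N (hwY o ho))
  have hE : E.encard ≤ p := encard_conjugatesOfSet_le hF hFB
  have hconj : ∀ x ∈ E, ∀ g : G, g * x * g⁻¹ ∈ E := fun x hx g =>
    Group.conj_mem_conjugatesOfSet hx
  have hFE : F ⊆ Subgroup.closure E :=
    Group.subset_conjugatesOfSet.trans Subgroup.subset_closure
  have haE : a ∈ Subgroup.closure E := hFE (Set.mem_insert _ _)
  have hwE : ∀ o ∈ O, w o ∈ Subgroup.closure E := fun o ho =>
    hFE (Set.mem_insert_of_mem _ ⟨o, ho, rfl⟩)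
  have hTn : (Subgroup.closure E).Normal := Subgroup.closure_normal_of_conj_mem hconj
  refine ⟨⁅Subgroup.closure E, Subgroup.closure E⁆,
    Subgroup.centralizer (Subgroup.closure E : Set G), inferInstance, inferInstance,
    Subgroup.encard_commutator_closure_le hE hconj,
    Subgroup.index_centralizer_closure_le hE hconj, ?_⟩
  intro u hu hle k hk
  have hcomm : ∀ o ∈ O, w o * u = u * w o := fun o ho =>
    Subgroup.mem_centralizer_iff.1 hu _ (hwE o ho)
  have hsub : (fun o => u * o) '' O ⊆ conjOrbit K (u * a) := by
    rintro _ ⟨o, ho, rfl⟩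
    refine ⟨w o, hwK o ho, ?_⟩
    calc w o * (u * a) * (w o)⁻¹ = (w o * u) * a * (w o)⁻¹ := by group
      _ = u * (w o * a * (w o)⁻¹) := by rw [hcomm o ho]; group
      _ = u * o := by rw [hwa o ho]
  have hfin' : (conjOrbit K (u * a)).Finite := Set.finite_of_encard_le_coe (hle.trans hO)
  have heq := hfin'.eq_of_subset_of_encard_le' hsub
    (by rwa [(mul_right_injective u).encard_image])
  obtain ⟨o, ho, hko⟩ : k * (u * a) * k⁻¹ ∈ (fun o => u * o) '' O := by
    rw [heq]
    exact ⟨k, hk, rfl⟩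
  have hk' : k * a * k⁻¹ ∈ O := ⟨k, hk, rfl⟩
  set o' := k * a * k⁻¹ with ho'
  have h2 : k * u * k⁻¹ = u * (o * o'⁻¹) := by
    have : k * u * k⁻¹ * o' = u * o := by
      simp only at hko
      rw [ho', hko]
      group
    rw [← mul_assoc, ← this]
    group
  -- Both orbit points are conjugates of `a` by elements of T, so their quotient lies in T'.
  have h3 : o * o'⁻¹ = ⁅w o, a⁆ * ⁅w o', a⁆⁻¹ := by
    simp only [commutatorElement_def, hwa o ho, hwa o' hk']
    group
  have h4 : ⁅k, u⁆ = u * (⁅w o, a⁆ * ⁅w o', a⁆⁻¹) * u⁻¹ := by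
    rw [commutatorElement_def, h2, h3]
  rw [h4]
  refine Subgroup.Normal.conj_mem inferInstance _ (Subgroup.mul_mem _ ?_ (Subgroup.inv_mem _ ?_)) u
  · exact Subgroup.commutator_mem_commutator (hwE o ho) haE
  · exact Subgroup.commutator_mem_commutator (hwE o' hk') haE

theorem exists_forall_encard_conjOrbit_le {G : Type u} [Group G] (K : Subgroup G) {N : ℕ}
    {A : Set G} (hne : A.Nonempty) (hA : A ⊆ Bset N G) :
    ∃ a ∈ A, ∀ x ∈ A, (conjOrbit K x).encard ≤ (conjOrbit K a).encard := by
  have hb : ∀ x ∈ A, (conjOrbit K x).encard ≤ N := fun x hx =>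
    (Set.encard_mono (conjOrbit_subset_conjugatesOf K x)).trans (hA hx)
  have hmem := Nat.sSup_mem (s := (fun x => (conjOrbit K x).ncard) '' A) (hne.image _)
    ⟨N, by
      rintro _ ⟨x, hx, rfl⟩
      exact_mod_cast ((Set.finite_of_encard_le_coe (hb x hx)).cast_ncard_eq).trans_le (hb x hx)⟩
  obtain ⟨a, ha, hmax⟩ := hmem
  refine ⟨a, ha, fun x hx => ?_⟩
  have h : (conjOrbit K x).ncard ≤ (conjOrbit K a).ncard := by
    simp only at hmax
    rw [hmax]
    refine le_csSup ⟨N, ?_⟩ ⟨x, hx, rfl⟩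
    rintro _ ⟨y, hy, rfl⟩
    exact_mod_cast ((Set.finite_of_encard_le_coe (hb y hy)).cast_ncard_eq).trans_le (hb y hy)
  rw [← (Set.finite_of_encard_le_coe (hb x hx)).cast_ncard_eq,
    ← (Set.finite_of_encard_le_coe (hb a ha)).cast_ncard_eq]
  exact_mod_cast h

/-- **Neumann's BFC theorem**. -/
theorem exists_bound_card_commutator_of_Bset_eq_univ (n : ℕ) : ∃ b : ℕ,
    ∀ (G : Type u) [Group G], (∀ x : G, x ∈ Bset n G) →
      Finite (commutator G) ∧ Nat.card (commutator G) ≤ b := by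
  obtain ⟨b, c, h⟩ := exists_absorbing_subgroups.{u} n
  refine ⟨schurBound (c * c * b), fun G _ hG => ?_⟩
  -- With `a` of largest class, absorption applies to every element of `U`, so [G,U] ≤ R.
  obtain ⟨a, -, ha⟩ := exists_forall_encard_conjOrbit_le (⊤ : Subgroup G) (A := Set.univ)
    ⟨1, trivial⟩ (fun x _ => hG x)
  obtain ⟨R, U, hR, hU, hRb, hUc, hRU⟩ := h G Set.univ trivial (fun _ _ => trivial)
    (fun x _ => hG x) a (hG a)
  rw [Subgroup.closure_univ] at hRU
  exact card_commutator_le_of_commutator_mem hUc hRb fun u hu g =>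
    hRU u hu (ha _ trivial) g trivial

end Absorption

/-! ### Levels at which small elements are closed under products. -/

section StableLevel

theorem pos_of_mem_Bset {G : Type u} [Group G] {n : ℕ} {x : G} (hx : x ∈ Bset n G) : 0 < n := by
  have := mem_Bset_iff.1 hx
  omega

/-- A set covered by `k` translates of `Bset N G` has, at some bounded level `N'`, no elements in
`Bset (N' * N') G` outside `Bset N' G`. -/
theorem exists_stable_level (k : ℕ) : ∀ N : ℕ, ∃ r : ℕ, ∀ (G : Type u) [Group G] (X T : Set G),
    1 ∈ T → T.encard ≤ k → X ⊆ T * Bset N G →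
      ∃ N' ≤ r, ∃ T' ⊆ T, 1 ∈ T' ∧ X ⊆ T' * Bset N' G ∧
        ∀ x ∈ X, x ∈ Bset (N' * N') G → x ∈ Bset N' G := by
  induction k with
  | zero =>
    refine fun N => ⟨0, fun G _ X T h1 hT => ?_⟩
    have : T = ∅ := by simpa using hT
    simp [this] at h1
  | succ k ih =>
    intro N
    obtain ⟨r, hr⟩ := ih (N * N * N * N)
    refine ⟨max N r, fun G _ X T h1 hT hX => ?_⟩
    by_cases hst : ∀ x ∈ X, x ∈ Bset (N * N) G → x ∈ Bset N G
    · exact ⟨N, le_max_left _ _, T, subset_rfl, h1, hX, hst⟩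
    push Not at hst
    obtain ⟨x, hxX, hx2, hxN⟩ := hst
    obtain ⟨t, ht, b, hb, rfl⟩ := hX hxX
    have hN := pos_of_mem_Bset hb
    have ht1 : t ≠ 1 := by
      rintro rfl
      exact hxN (by simpa using hb)
    -- An unstable `x = t * b` makes `t` itself small: the translate of `Bset N G` by `t` falls into
    -- the translate of the fourth-power level by `1`. Thus `t` can be dropped, and the induction is
    -- on the number of translates.
    have htB : t ∈ Bset (N * N * N) G := by
      simpa using mul_mem_Bset hx2 (inv_mem_Bset hb)
    have hle : N ≤ N * N * N * N := Nat.le_mul_of_pos_left N (by positivity)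
    obtain ⟨N', hN', T', hT', h⟩ := hr G X (T \ {t}) ⟨h1, fun h => ht1 h.symm⟩ (by
      have := Set.encard_sdiff_singleton_add_one ht
      rw [← this] at hT
      push_cast at hT
      exact (ENat.add_le_add_iff_right ENat.one_ne_top).1 hT) (by
      intro y hy
      obtain ⟨s, hs, c, hc, rfl⟩ := hX hy
      by_cases hst : s = t
      · subst hst
        exact ⟨1, ⟨h1, fun h => ht1 h.symm⟩, _, mul_mem_Bset htB hc, one_mul _⟩
      · exact ⟨s, ⟨hs, hst⟩, c, Bset_mono hle hc, rfl⟩)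
    exact ⟨N', hN'.trans (le_max_right _ _), T', hT'.trans Set.sdiff_subset, h⟩

/-- A group covered by boundedly many translates of `Bset M G` is
finite-by-abelian-by-finite, in a bounded and characteristic way. -/
theorem exists_characteristic_of_covering (k M : ℕ) : ∃ b : ℕ, ∀ (G : Type u) [Group G] (T : Set G),
    T.encard ≤ k → Set.univ ⊆ T * Bset M G →
      ∃ B : Subgroup G, B.Characteristic ∧ B.FiniteIndex ∧ B.index ≤ b ∧
        Finite (commutator B) ∧ Nat.card (commutator B) ≤ b := by
  obtain ⟨r, hr⟩ := exists_stable_level.{u} (k + 1) M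
  choose c hc using exists_bound_card_commutator_of_Bset_eq_univ.{u}
  refine ⟨max (k + 1) ((Finset.range (r + 1)).sup c), fun G _ T hT hcov => ?_⟩
  have hT1 : (insert 1 T).encard ≤ (k + 1 : ℕ) := by
    refine (Set.encard_insert_le _ _).trans ?_
    push_cast
    exact add_le_add_left hT 1
  obtain ⟨N, hN, T', hT', h1, hcov', hst⟩ := hr G Set.univ (insert 1 T) (Set.mem_insert _ _) hT1
    (hcov.trans (Set.mul_subset_mul_right (Set.subset_insert _ _)))
  have hT'k : T'.encard ≤ (k + 1 : ℕ) := (Set.encard_mono hT').trans hT1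
  have hNpos : 0 < N := by
    obtain ⟨-, -, b, hb, -⟩ := hcov' (Set.mem_univ 1)
    exact pos_of_mem_Bset hb
  -- Stability is exactly closure under multiplication here.
  let B : Subgroup G :=
    { carrier := Bset N G
      one_mem' := one_mem_Bset hNpos
      mul_mem' := fun hx hy => hst _ trivial (mul_mem_Bset hx hy)
      inv_mem' := fun hx => inv_mem_Bset hx }
  have hidx : B.index ≠ 0 ∧ B.index ≤ k + 1 := by
    choose t ht d hd htd using fun x : G => hcov' (Set.mem_univ x)
    refine Subgroup.index_le_of_fiber t ((Set.encard_mono ?_).trans hT'k) ?_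
    · rintro _ ⟨x, rfl⟩
      exact ht x
    · intro x y hxy
      have : x⁻¹ * y = (d x)⁻¹ * d y := by
        have hdx : d x = (t x)⁻¹ * x := eq_inv_mul_of_mul_eq (htd x)
        have hdy : d y = (t y)⁻¹ * y := eq_inv_mul_of_mul_eq (htd y)
        rw [hdx, hdy, hxy]
        group
      rw [this]
      exact B.mul_mem (B.inv_mem (hd x)) (hd y)
  obtain ⟨hfin, hcard⟩ := hc N B fun x => mem_Bset_subtype B x.2
  refine ⟨B, ?_, ⟨hidx.1⟩, hidx.2.trans (le_max_left _ _), hfin,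
    hcard.trans ((Finset.le_sup (f := c) ?_).trans (le_max_right _ _))⟩
  · rw [Subgroup.characteristic_iff_map_le]
    rintro φ _ ⟨x, hx, rfl⟩
    exact map_mem_Bset φ hx
  · rw [Finset.mem_range]
    omega

end StableLevel

/-! ### Bounded commutator width for abelian-by-finite groups. -/

section AbelianByFinite

theorem Subgroup.commutatorElement_mem_of_mem_left {Q : Type u} [Group Q] {A : Subgroup Q}
    [A.Normal] {a : Q} (ha : a ∈ A) (g : Q) : ⁅a, g⁆ ∈ A :=
  Subgroup.commutator_le_left A ⊤ (Subgroup.commutator_mem_commutator ha trivial)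

/-- Commutators of elements of an abelian normal subgroup with a fixed element, as a
homomorphism. -/
def commutatorHom {Q : Type u} [Group Q] (A : Subgroup Q) [A.Normal]
    (hA : ∀ a ∈ A, ∀ b ∈ A, a * b = b * a) (g : Q) : A →* A :=
  MonoidHom.mk' (fun a => ⟨⁅(a : Q), g⁆, Subgroup.commutatorElement_mem_of_mem_left a.2 g⟩) (by
    intro a b
    have hc : ∀ x : A, ⁅(x : Q), g⁆ ∈ A := fun x =>
      Subgroup.commutatorElement_mem_of_mem_left x.2 g
    refine Subtype.ext ?_
    change ⁅(a : Q) * b, g⁆ = ⁅(a : Q), g⁆ * ⁅(b : Q), g⁆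
    rw [commutatorElement_mul_left_eq_conj_mul, hA a a.2 _ (hc b), mul_inv_cancel_right]
    exact hA _ (hc b) _ (hc a))

/-- For abelian `A` the endomorphism a ↦ [a,g] of `A` depends only on the coset of g. So [A,Q] is
the product of at most `v` images of such maps, each consisting of single commutators. -/
theorem commutator_subset_commutatorSet_pow {Q : Type u} [Group Q] {A : Subgroup Q} [A.Normal]
    (hA : ∀ a ∈ A, ∀ b ∈ A, a * b = b * a) {v : ℕ} (hv : A.index ≠ 0 ∧ A.index ≤ v) :
    ((⁅A, (⊤ : Subgroup Q)⁆ : Subgroup Q) : Set Q) ⊆ commutatorSet Q ^ v := by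
  classical
  let : CommGroup A := { mul_comm := fun a b => Subtype.ext (hA a a.2 b b.2) }
  have : Finite (Q ⧸ A) := Subgroup.index_ne_zero_iff_finite.1 hv.1
  let := Fintype.ofFinite (Q ⧸ A)
  let φ : Q ⧸ A → A →* A := fun q => commutatorHom A hA q.out
  let Φ : (Q ⧸ A → A) →* A :=
    { toFun := fun f => ∏ q, φ q (f q)
      map_one' := by simp
      map_mul' := fun f g => by simp [Finset.prod_mul_distrib] }
  have hle : ⁅A, (⊤ : Subgroup Q)⁆ ≤ Φ.range.map A.subtype := by
    rw [Subgroup.commutator_le]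
    intro a ha g _
    refine ⟨_, ⟨Pi.mulSingle (g : Q ⧸ A) ⟨a, ha⟩, rfl⟩, ?_⟩
    have h1 : Φ (Pi.mulSingle (g : Q ⧸ A) ⟨a, ha⟩) = φ g ⟨a, ha⟩ := by
      change ∏ q, φ q _ = _
      rw [Finset.prod_eq_single (g : Q ⧸ A)]
      · simp
      · intro q _ hq
        simp [Pi.mulSingle_eq_of_ne hq]
      · simp
    rw [h1]
    obtain ⟨u, hu⟩ := QuotientGroup.mk_out_eq_mul A g
    change ⁅a, (g : Q ⧸ A).out⁆ = ⁅a, g⁆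
    rw [hu, commutatorElement_mul_right_eq_mul_conj,
      commutatorElement_eq_one_iff_mul_comm.2 (hA a ha u u.2)]
    simp
  have hprod : ∀ (f : Q ⧸ A → A) (s : Finset (Q ⧸ A)),
      ((∏ q ∈ s, φ q (f q) : A) : Q) ∈ commutatorSet Q ^ s.card := by
    intro f s
    induction s using Finset.induction_on with
    | empty => simp
    | insert q s hq ih =>
      rw [Finset.prod_insert hq, Finset.card_insert_of_notMem hq, pow_succ']
      exact Set.mul_mem_mul ⟨f q, q.out, rfl⟩ ih
  intro x hx
  obtain ⟨_, ⟨f, rfl⟩, rfl⟩ := hle hx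
  refine Set.pow_subset_pow_right (one_mem_commutatorSet Q) ?_ (hprod f Finset.univ)
  rw [Finset.card_univ, ← Nat.card_eq_fintype_card]
  exact hv.2

/-- Modulo [A,Q] the image of `A` is central, so Schur bounds the derived subgroup there and short
words in commutators represent it; the error in [A,Q] costs `v` further commutators. -/
theorem exists_commutator_subset_commutatorSet_pow (v : ℕ) : ∃ r : ℕ, ∀ (Q : Type u) [Group Q]
    (A : Subgroup Q), A.Normal → (∀ a ∈ A, ∀ b ∈ A, a * b = b * a) →
      (A.index ≠ 0 ∧ A.index ≤ v) → (commutator Q : Set Q) ⊆ commutatorSet Q ^ r := by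
  refine ⟨schurBound (v * v * 1) + v, fun Q _ A _ hA hv h hh => ?_⟩
  let D : Subgroup Q := ⁅A, ⊤⁆
  have hidx := Subgroup.index_map_bound (QuotientGroup.mk'_surjective D) hv
  obtain ⟨hfin, hcard⟩ := card_commutator_le_of_commutator_mem (R := (⊥ : Subgroup (Q ⧸ D)))
    (q := 1) hidx (by rw [Subgroup.coe_bot, Set.encard_singleton]; simp) (by
      rintro _ ⟨a, ha, rfl⟩ g
      obtain ⟨g, rfl⟩ := QuotientGroup.mk'_surjective D g
      rw [Subgroup.mem_bot, ← map_commutatorElement, ← MonoidHom.mem_ker, QuotientGroup.ker_mk',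
        ← commutatorElement_inv]
      exact D.inv_mem (Subgroup.commutator_mem_commutator ha trivial))
  have himage : ((fun g : Q => (g : Q ⧸ D)) '' (Subgroup.closure (commutatorSet Q) : Set Q)).encard
      ≤ schurBound (v * v * 1) := by
    have hsub : (fun g : Q => (g : Q ⧸ D)) '' (Subgroup.closure (commutatorSet Q) : Set Q) ⊆
        (commutator (Q ⧸ D) : Set (Q ⧸ D)) := by
      rintro _ ⟨g, hg, rfl⟩
      rw [← commutator_eq_closure] at hg
      exact map_mem_commutator (QuotientGroup.mk' D) hg
    exact (Set.encard_mono hsub).trans (Subgroup.encard_coe_le_of_card_le hcard)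
  rw [commutator_eq_closure] at hh
  obtain ⟨w, hw, hwh⟩ := exists_mem_pow_inv_mul_mem D (one_mem_commutatorSet Q) (by
    rintro _ ⟨x, y, rfl⟩
    exact ⟨y, x, (commutatorElement_inv x y).symm⟩) himage hh
  rw [pow_add]
  exact ⟨w, hw, _, commutator_subset_commutatorSet_pow hA hv hwh, mul_inv_cancel_left _ _⟩

end AbelianByFinite

/-! ### Subgroups cut out by small commutators. -/

section Centralizers

variable {G : Type u} [Group G]

/-- The elements `u` whose commutator with `e` has at most `N` conjugates, at a level `N` where
they form a subgroup. -/
def smallCommutatorSubgroup {N : ℕ} (hN : 0 < N)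
    (hst : ∀ x ∈ commutatorSet G, x ∈ Bset (N * N) G → x ∈ Bset N G) (e : G) : Subgroup G where
  carrier := {u | ⁅u, e⁆ ∈ Bset N G}
  one_mem' := by
    change ⁅(1 : G), e⁆ ∈ Bset N G
    rw [commutatorElement_one_left]
    exact one_mem_Bset hN
  mul_mem' := by
    intro u v hu hv
    refine hst _ ⟨_, _, rfl⟩ ?_
    rw [commutatorElement_mul_left_eq_conj_mul]
    exact mul_mem_Bset (conj_mem_Bset u hv) hu
  inv_mem' := by
    intro u hu
    change ⁅u⁻¹, e⁆ ∈ Bset N G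
    rw [commutatorElement_inv_left, ← commutatorElement_inv]
    have := conj_mem_Bset u⁻¹ (inv_mem_Bset (show ⁅u, e⁆ ∈ Bset N G from hu))
    rwa [inv_inv] at this

theorem mem_smallCommutatorSubgroup {N : ℕ} {hN : 0 < N}
    {hst : ∀ x ∈ commutatorSet G, x ∈ Bset (N * N) G → x ∈ Bset N G} {e u : G} :
    u ∈ smallCommutatorSubgroup hN hst e ↔ ⁅u, e⁆ ∈ Bset N G := Iff.rfl

/-- If [x,e] and [y,e] lie in the same translate, then [x⁻¹y,e] is conjugate to a quotient of two
elements of `Bset N G`, and stability brings it back to level `N`. -/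
theorem index_smallCommutatorSubgroup_le {N k : ℕ} (hN : 0 < N)
    (hst : ∀ x ∈ commutatorSet G, x ∈ Bset (N * N) G → x ∈ Bset N G) (e : G) {S : Set G}
    (hS : S.encard ≤ k) (hcov : commutatorSet G ⊆ S * Bset N G) :
    (smallCommutatorSubgroup hN hst e).index ≠ 0 ∧
      (smallCommutatorSubgroup hN hst e).index ≤ k := by
  choose s hs b hb hsb using fun u : G => hcov (⟨u, e, rfl⟩ : ⁅u, e⁆ ∈ commutatorSet G)
  refine Subgroup.index_le_of_fiber s ((Set.encard_mono ?_).trans hS) ?_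
  · rintro _ ⟨x, rfl⟩
    exact hs x
  · intro x y hxy
    rw [mem_smallCommutatorSubgroup]
    refine hst _ ⟨_, _, rfl⟩ (mem_Bset_of_conj_mem ((s x)⁻¹ * x) ?_)
    have hx : ⁅x, e⁆ = s x * b x := (hsb x).symm
    have hy : ⁅y, e⁆ = s x * b y := by rw [hxy]; exact (hsb y).symm
    have h : (s x)⁻¹ * x * ⁅x⁻¹ * y, e⁆ * ((s x)⁻¹ * x)⁻¹ =
        (s x)⁻¹ * (⁅y, e⁆ * ⁅x, e⁆⁻¹) * s x := by
      simp only [commutatorElement_def]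
      group
    rw [h, hx, hy]
    have h2 : (s x)⁻¹ * (s x * b y * (s x * b x)⁻¹) * s x = b y * (b x)⁻¹ := by group
    rw [h2]
    exact mul_mem_Bset (hb y) (inv_mem_Bset (hb x))

theorem exists_normal_centralizer_mod (K R : Subgroup G) [K.Normal] [R.Normal] :
    ∃ Z : Subgroup G, Z.Normal ∧ ∀ g, g ∈ Z ↔ ∀ k ∈ K, ⁅k, g⁆ ∈ R := by
  have hK : (K.map (QuotientGroup.mk' R)).Normal :=
    Subgroup.Normal.map inferInstance _ (QuotientGroup.mk'_surjective R)
  refine ⟨(Subgroup.centralizer (K.map (QuotientGroup.mk' R) : Set (G ⧸ R))).comap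
    (QuotientGroup.mk' R), inferInstance, fun g => ?_⟩
  rw [Subgroup.mem_comap, Subgroup.mem_centralizer_iff]
  have key : ∀ k : G, ⁅k, g⁆ ∈ R ↔ QuotientGroup.mk' R k * QuotientGroup.mk' R g =
      QuotientGroup.mk' R g * QuotientGroup.mk' R k := fun k => by
    rw [← commutatorElement_eq_one_iff_mul_comm, ← map_commutatorElement, ← MonoidHom.mem_ker,
      QuotientGroup.ker_mk']
  constructor
  · exact fun h k hk => (key k).2 (h _ ⟨k, hk, rfl⟩)
  · rintro h _ ⟨k, hk, rfl⟩
    exact (key k).1 (h k hk)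

/-- The elements of `G'` with at most `n` conjugates in `G`. -/
def smallDerivedSet (n : ℕ) (G : Type u) [Group G] : Set G := (commutator G : Set G) ∩ Bset n G

theorem normal_closure_smallDerivedSet (n : ℕ) :
    (Subgroup.closure (smallDerivedSet n G)).Normal :=
  Subgroup.closure_normal_of_conj_mem fun _ hx g =>
    ⟨Subgroup.Normal.conj_mem inferInstance _ hx.1 g, conj_mem_Bset g hx.2⟩

theorem commutatorSet_subset_commutator : commutatorSet G ⊆ (commutator G : Set G) := by
  rw [commutator_eq_closure]
  exact Subgroup.subset_closure

/-- Since `S` consists of commutators, the small factors of the covering lie in G' and die in the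
quotient. At most `k` commutators survive, and Schur's theorem applies. -/
theorem encard_image_commutator_quotient_le {k N : ℕ} {S : Set G} (hSX : S ⊆ commutatorSet G)
    (hS : S.encard ≤ k) (hcov : commutatorSet G ⊆ S * Bset N G) :
    ((fun g : G => (g : G ⧸ Subgroup.closure (smallDerivedSet N G))) ''
      (commutator G : Set G)).encard ≤ schurBound k := by
  have hKn : (Subgroup.closure (smallDerivedSet N G)).Normal := normal_closure_smallDerivedSet N
  set K := Subgroup.closure (smallDerivedSet N G)
  have hset : commutatorSet (G ⧸ K) ⊆ (fun g : G => (g : G ⧸ K)) '' S := by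
    rintro _ ⟨x, y, rfl⟩
    obtain ⟨x, rfl⟩ := QuotientGroup.mk'_surjective K x
    obtain ⟨y, rfl⟩ := QuotientGroup.mk'_surjective K y
    obtain ⟨s, hs, b, hb, hsb⟩ := hcov (⟨x, y, rfl⟩ : ⁅x, y⁆ ∈ commutatorSet G)
    refine ⟨s, hs, ?_⟩
    rw [← map_commutatorElement]
    refine QuotientGroup.eq.2 ?_
    have hb' : s⁻¹ * ⁅x, y⁆ = b := by rw [← hsb]; simp
    rw [hb']
    refine Subgroup.subset_closure ⟨?_, hb⟩
    rw [← hb']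
    exact Subgroup.mul_mem _ (Subgroup.inv_mem _ (commutatorSet_subset_commutator (hSX hs)))
      (commutatorSet_subset_commutator ⟨x, y, rfl⟩)
  obtain ⟨hfin, hcard⟩ := card_commutator_le_schurBound
    ((Set.encard_mono hset).trans ((Set.encard_image_le _ _).trans hS))
  have hsub : (fun g : G => (g : G ⧸ K)) '' (commutator G : Set G) ⊆
      (commutator (G ⧸ K) : Set (G ⧸ K)) := by
    rintro _ ⟨g, hg, rfl⟩
    exact map_mem_commutator (QuotientGroup.mk' K) hg
  exact (Set.encard_mono hsub).trans (Subgroup.encard_coe_le_of_card_le hcard)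

end Centralizers

/-! ### Perturbing a commutator with maximal orbit. -/

section StableCase

/-- With a = [d,e] of maximal orbit, [dx,e] and [dx,ey] have the form ua with u ∈ U, and stability
keeps them at level `N`. Absorption puts each u in Z; comparing the two gives [dx,y] ∈ Z. -/
theorem exists_subgroup_with_small_commutators (k N : ℕ) : ∃ b c : ℕ,
    ∀ (G : Type u) [Group G] (S : Set G), S.encard ≤ k → commutatorSet G ⊆ S * Bset N G →
      (∀ x ∈ commutatorSet G, x ∈ Bset (N * N) G → x ∈ Bset N G) →
      ∃ R Z V : Subgroup G, R.Normal ∧ Z.Normal ∧ (R : Set G).encard ≤ b ∧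
        (V.index ≠ 0 ∧ V.index ≤ c) ∧
        (∀ z ∈ Z, ∀ x ∈ Subgroup.closure (smallDerivedSet N G), ⁅x, z⁆ ∈ R) ∧
        ∀ x ∈ V, ∃ W : Subgroup G, (W.index ≠ 0 ∧ W.index ≤ k) ∧
          ∀ y ∈ V, y ∈ W → ⁅x, y⁆ ∈ Z := by
  obtain ⟨b, c, h⟩ := exists_absorbing_subgroups.{u} N
  refine ⟨b, c * (k * k), fun G _ S hS hcov hst => ?_⟩
  have hN : 0 < N := by
    obtain ⟨-, -, x, hx, -⟩ := hcov (one_mem_commutatorSet G)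
    exact pos_of_mem_Bset hx
  have hKn : (Subgroup.closure (smallDerivedSet N G)).Normal := normal_closure_smallDerivedSet N
  obtain ⟨a, ⟨⟨d, e, hde⟩, haB⟩, hmax⟩ := exists_forall_encard_conjOrbit_le
    (Subgroup.closure (smallDerivedSet N G)) (A := commutatorSet G ∩ Bset N G)
    ⟨1, one_mem_commutatorSet G, one_mem_Bset hN⟩ Set.inter_subset_right
  obtain ⟨R, U, hR, hU, hRb, hUc, hRU⟩ := h G (smallDerivedSet N G)
    ⟨Subgroup.one_mem _, one_mem_Bset hN⟩
    (fun y hy => ⟨Subgroup.inv_mem _ hy.1, inv_mem_Bset hy.2⟩) Set.inter_subset_right a haB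
  obtain ⟨Z, hZ, hZmem⟩ := exists_normal_centralizer_mod
    (Subgroup.closure (smallDerivedSet N G)) R
  let E := smallCommutatorSubgroup hN hst
  have hEk : ∀ g, (E g).index ≠ 0 ∧ (E g).index ≤ k := fun g =>
    index_smallCommutatorSubgroup_le hN hst g hS hcov
  have hEsymm : ∀ {x y : G}, y ∈ E x → ⁅x, y⁆ ∈ Bset N G := by
    intro x y hy
    rw [← commutatorElement_inv]
    exact inv_mem_Bset (mem_smallCommutatorSubgroup.1 hy)
  have hUZ : ∀ u ∈ U, u * a ∈ commutatorSet G → u * a ∈ Bset N G → u ∈ Z := fun u hu h1 h2 =>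
    (hZmem u).2 (hRU u hu (hmax _ ⟨h1, h2⟩))
  have hleft : ∀ x ∈ U ⊓ E e, d * ⁅x, e⁆ * d⁻¹ ∈ Z ∧ d * ⁅x, e⁆ * d⁻¹ ∈ U ∧
      ⁅d * x, e⁆ ∈ Bset N G ∧ ⁅d * x, e⁆ = d * ⁅x, e⁆ * d⁻¹ * a := by
    rintro x ⟨hxU, hxE⟩
    have h1 : ⁅d * x, e⁆ = d * ⁅x, e⁆ * d⁻¹ * a := by
      rw [commutatorElement_mul_left_eq_conj_mul, hde]
    have h2 : ⁅d * x, e⁆ ∈ Bset N G := by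
      refine hst _ ⟨_, _, rfl⟩ ?_
      rw [h1]
      exact mul_mem_Bset (conj_mem_Bset d (mem_smallCommutatorSubgroup.1 hxE)) haB
    have h3 : d * ⁅x, e⁆ * d⁻¹ ∈ U :=
      hU.conj_mem _ (Subgroup.commutatorElement_mem_of_mem_left hxU e) d
    refine ⟨hUZ _ h3 ?_ ?_, h3, h2, h1⟩
    · rw [← h1]
      exact ⟨_, _, rfl⟩
    · rwa [← h1]
  have hright : ∀ x ∈ U ⊓ E e, ∀ y ∈ U ⊓ E (d * x), ⁅d * x, y⁆ ∈ Z := by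
    rintro x hx y ⟨hyU, hyE⟩
    obtain ⟨hxZ, hxU, hxB, hxeq⟩ := hleft x hx
    have hxyB : ⁅d * x, y⁆ ∈ Bset N G := hEsymm hyE
    have hxyU : ⁅d * x, y⁆ ∈ U := by
      rw [← commutatorElement_inv]
      exact U.inv_mem (Subgroup.commutatorElement_mem_of_mem_left hyU _)
    set p := ⁅d * x, e⁆ with hp
    have h1 : ⁅d * x, e * y⁆ = p * (e * ⁅d * x, y⁆ * e⁻¹) := by
      rw [commutatorElement_mul_right_eq_mul_conj, ← hp]
      group
    have h2 : ⁅d * x, e * y⁆ ∈ Bset N G := by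
      refine hst _ ⟨_, _, rfl⟩ ?_
      rw [h1]
      exact mul_mem_Bset hxB (conj_mem_Bset e hxyB)
    have h3 : ⁅d * x, e * y⁆ =
        (p * (e * ⁅d * x, y⁆ * e⁻¹) * p⁻¹ * (d * ⁅x, e⁆ * d⁻¹)) * a := by
      rw [mul_assoc _ _ a, ← hxeq, h1]
      group
    have h4 : p * (e * ⁅d * x, y⁆ * e⁻¹) * p⁻¹ * (d * ⁅x, e⁆ * d⁻¹) ∈ Z := by
      refine hUZ _ (U.mul_mem (hU.conj_mem _ (hU.conj_mem _ hxyU e) p) hxU) ?_ ?_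
      · rw [← h3]
        exact ⟨_, _, rfl⟩
      · rwa [← h3]
    have h5 := (Subgroup.mul_mem_cancel_right Z hxZ).1 h4
    have h6 := hZ.conj_mem _ h5 (p * e)⁻¹
    convert h6 using 1
    group
  refine ⟨R, Z, U ⊓ (E e ⊓ E d), hR, hZ, hRb,
    Subgroup.index_inf_bound hUc (Subgroup.index_inf_bound (hEk e) (hEk d)),
    fun z hz => (hZmem z).1 hz, ?_⟩
  rintro x ⟨hxU, hxe, -⟩
  refine ⟨E (d * x), hEk _, ?_⟩
  rintro y ⟨hyU, -, hyd⟩ hyW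
  have h1 := hright x ⟨hxU, hxe⟩ y ⟨hyU, hyW⟩
  -- The case x = 1 gives [d,y] ∈ Z, which is cancelled from [dx,y] to leave a conjugate of [x,y].
  -- This is why `V` is cut down by `E d`.
  have h2 := hright 1 (Subgroup.one_mem _) y ⟨hyU, by rwa [mul_one]⟩
  rw [mul_one] at h2
  rw [commutatorElement_mul_left_eq_conj_mul] at h1
  have h3 := (Subgroup.mul_mem_cancel_right Z h2).1 h1
  have h4 := hZ.conj_mem _ h3 d⁻¹
  convert h4 using 1
  group

end StableCase

/-! ### Factoring the elements of G'. -/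

section DerivedCovering

/-- The hypothesis bounds all conjugacy classes of V/(V ∩ Z) by `k`, so Neumann's theorem bounds its
derived subgroup. -/
theorem exists_commutator_subset_mul (k : ℕ) : ∃ b : ℕ, ∀ (G : Type u) [Group G]
    (V Z : Subgroup G), Z.Normal →
      (∀ x ∈ V, ∃ W : Subgroup G, (W.index ≠ 0 ∧ W.index ≤ k) ∧
        ∀ y ∈ V, y ∈ W → ⁅x, y⁆ ∈ Z) →
      ∃ C : Set G, C.encard ≤ b ∧ ((⁅V, V⁆ : Subgroup G) : Set G) ⊆ C * (Z : Set G) := by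
  obtain ⟨b, hb⟩ := exists_bound_card_commutator_of_Bset_eq_univ.{u} k
  refine ⟨b, fun G _ V Z _ hV => ?_⟩
  let L := Z.subgroupOf V
  obtain ⟨hfin, hcard⟩ := hb (V ⧸ L) (by
    intro q
    obtain ⟨x, rfl⟩ := QuotientGroup.mk'_surjective L q
    obtain ⟨W, hWk, hW⟩ := hV x x.2
    rw [mem_Bset_iff]
    refine Subgroup.index_le_of_le_of_bound ?_ (Subgroup.index_map_bound
      (QuotientGroup.mk'_surjective L) (Subgroup.index_subgroupOf_bound V hWk))
    rintro _ ⟨y, hy, rfl⟩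
    rw [Subgroup.mem_centralizer_singleton_iff, eq_comm, ← commutatorElement_eq_one_iff_mul_comm,
      ← map_commutatorElement, ← MonoidHom.mem_ker, QuotientGroup.ker_mk']
    exact Subgroup.mem_subgroupOf.2 (hW y y.2 (Subgroup.mem_subgroupOf.1 hy)))
  refine ⟨(fun q : V ⧸ L => (q.out : G)) '' (commutator (V ⧸ L) : Set (V ⧸ L)),
    (Set.encard_image_le _ _).trans ?_, ?_⟩
  · exact Subgroup.encard_coe_le_of_card_le hcard
  · rw [← Subgroup.map_subtype_commutator]
    rintro _ ⟨v, hv, rfl⟩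
    have h1 := map_mem_commutator (QuotientGroup.mk' L) hv
    obtain ⟨z, hz⟩ := QuotientGroup.mk_out_eq_mul L v
    refine ⟨_, ⟨_, h1, rfl⟩, ((z : V) : G)⁻¹, Z.inv_mem (Subgroup.mem_subgroupOf.1 z.2), ?_⟩
    change (((v : V ⧸ L).out : V) : G) * ((z : V) : G)⁻¹ = v
    rw [hz]
    simp

theorem Subgroup.index_normalCore_bound {G : Type u} [Group G] {V : Subgroup G} {c : ℕ}
    (hV : V.index ≠ 0 ∧ V.index ≤ c) :
    V.normalCore.index ≠ 0 ∧ V.normalCore.index ≤ c.factorial := by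
  have : V.FiniteIndex := ⟨hV.1⟩
  have : Finite (G ⧸ V) := Subgroup.index_ne_zero_iff_finite.1 hV.1
  refine ⟨Subgroup.FiniteIndex.index_ne_zero, ?_⟩
  have h : V.normalCore.index ∣ V.index.factorial := by
    rw [Subgroup.normalCore_eq_ker, Subgroup.index_ker, Subgroup.index_eq_card, ← Nat.card_perm]
    exact Subgroup.card_subgroup_dvd_card _
  exact (Nat.le_of_dvd (Nat.factorial_pos _) h).trans (Nat.factorial_le hV.2)

/-- With A the normal core of `V`, the quotient by [A,A]Z is abelian-by-finite, hence of bounded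
commutator width, while [A,A]Z is contained in `C * Z`. -/
theorem exists_commutator_subset_commutatorSet_pow_mul (c : ℕ) : ∃ r : ℕ, ∀ (G : Type u) [Group G]
    (V Z : Subgroup G) (C : Set G), Z.Normal → (V.index ≠ 0 ∧ V.index ≤ c) →
      ((⁅V, V⁆ : Subgroup G) : Set G) ⊆ C * (Z : Set G) →
      (commutator G : Set G) ⊆ commutatorSet G ^ r * (C * (Z : Set G)) := by
  obtain ⟨r, hr⟩ := exists_commutator_subset_commutatorSet_pow.{u} c.factorial
  refine ⟨r, fun G _ V Z C _ hV hC h hh => ?_⟩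
  let A := V.normalCore
  let P : Subgroup G := ⁅A, A⁆ ⊔ Z
  let f := QuotientGroup.mk' P
  have hf : Function.Surjective f := QuotientGroup.mk'_surjective P
  have hP : (P : Set G) ⊆ C * (Z : Set G) := by
    intro x hx
    obtain ⟨y, hy, z, hz, rfl⟩ := Subgroup.mem_sup_of_normal_right.1 hx
    obtain ⟨s, hs, z', hz', rfl⟩ := hC (Subgroup.commutator_mono V.normalCore_le V.normalCore_le hy)
    exact ⟨s, hs, z' * z, Z.mul_mem hz' hz, (mul_assoc _ _ _).symm⟩
  have hpow := hr (G ⧸ P) (A.map f) (Subgroup.Normal.map inferInstance f hf) (by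
    rintro _ ⟨a, ha, rfl⟩ _ ⟨b, hb, rfl⟩
    rw [← commutatorElement_eq_one_iff_mul_comm, ← map_commutatorElement, ← MonoidHom.mem_ker,
      QuotientGroup.ker_mk']
    exact (le_sup_left : ⁅A, A⁆ ≤ P) (Subgroup.commutator_mem_commutator ha hb))
    (Subgroup.index_map_bound hf (Subgroup.index_normalCore_bound hV))
  have hfh : f h ∈ commutator (G ⧸ P) := map_mem_commutator f hh
  have himg : commutatorSet (G ⧸ P) ⊆ f '' commutatorSet G := by
    rintro _ ⟨x, y, rfl⟩
    obtain ⟨x, rfl⟩ := hf x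
    obtain ⟨y, rfl⟩ := hf y
    exact ⟨⁅x, y⁆, ⟨x, y, rfl⟩, map_commutatorElement f x y⟩
  have h1 := Set.pow_subset_pow_left himg (hpow hfh)
  rw [← Set.image_pow] at h1
  obtain ⟨w, hw, hwh⟩ := h1
  exact ⟨w, hw, w⁻¹ * h, hP (QuotientGroup.eq.1 hwh), mul_inv_cancel_left _ _⟩

theorem mul_Bset_pow_subset {G : Type u} [Group G] (S : Set G) (N r : ℕ) :
    (S * Bset N G) ^ r ⊆ S ^ r * Bset (N ^ r) G := by
  induction r with
  | zero =>
    simp only [pow_zero, one_mul, Set.one_subset]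
    exact one_mem_Bset one_pos
  | succ r ih =>
    rw [pow_succ, pow_succ, pow_succ]
    rintro _ ⟨x, hx, _, ⟨s, hs, b, hb, rfl⟩, rfl⟩
    obtain ⟨t, ht, d, hd, rfl⟩ := ih hx
    refine ⟨t * s, Set.mul_mem_mul ht hs, s⁻¹ * d * s⁻¹⁻¹ * b,
      mul_mem_Bset (conj_mem_Bset _ hd) hb, ?_⟩
    simp only
    group

/-- Conjugating bz by `K` stays in (conjugates of b)·R·z, and G' meets at most `s` cosets of `K`. -/
theorem mem_Bset_commutator_of_eq_mul {G : Type u} [Group G] {K R : Subgroup G} {s m q : ℕ}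
    (hK : ((fun g : G => (g : G ⧸ K)) '' (commutator G : Set G)).encard ≤ s)
    (hR : (R : Set G).encard ≤ q) {b z : G} (hb : b ∈ Bset m G) (hz : ∀ k ∈ K, ⁅k, z⁆ ∈ R)
    (y : commutator G) (hy : (y : G) = b * z) : y ∈ Bset (s * (m * q * 1)) (commutator G) := by
  have hz1 : ({z} : Set G).encard ≤ (1 : ℕ) := by rw [Set.encard_singleton]; simp
  change (conjugatesOf y).encard ≤ _
  rw [← Subtype.val_injective.encard_image]
  refine le_trans (Set.encard_mono ?_) (Set.encard_image2_le
    (fun (p : G ⧸ K) x => p.out * x * p.out⁻¹) hK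
    (Set.encard_mul_le (Set.encard_mul_le (show (conjugatesOf b).encard ≤ m from hb) hR) hz1))
  rintro _ ⟨x, hx, rfl⟩
  obtain ⟨h, rfl⟩ := isConj_iff.1 (show IsConj y x from hx)
  obtain ⟨k, hk⟩ := QuotientGroup.mk_out_eq_mul K (h : G)
  refine ⟨((h : G) : G ⧸ K), ⟨h, h.2, rfl⟩, (k : G)⁻¹ * y * k, ?_, ?_⟩
  · refine ⟨(k : G)⁻¹ * b * k * ⁅(k : G)⁻¹, z⁆, ⟨_, ?_, _, hz _ (K.inv_mem k.2), rfl⟩, z, rfl, ?_⟩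
    · exact isConj_iff.2 ⟨(k : G)⁻¹, by rw [inv_inv]⟩
    · simp only [hy, commutatorElement_def]
      group
  · simp only [hk]
    push_cast
    group

end DerivedCovering

/-! ### Covering G' and conclusion. -/

theorem exists_covering_of_stable (k N : ℕ) : ∃ t M : ℕ, ∀ (G : Type u) [Group G] (S : Set G),
    S ⊆ commutatorSet G → S.encard ≤ k → commutatorSet G ⊆ S * Bset N G →
      (∀ x ∈ commutatorSet G, x ∈ Bset (N * N) G → x ∈ Bset N G) →
      ∃ T : Set (commutator G), T.encard ≤ t ∧ Set.univ ⊆ T * Bset M (commutator G) := by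
  obtain ⟨q, c, hsub⟩ := exists_subgroup_with_small_commutators.{u} k N
  obtain ⟨p, hp⟩ := exists_commutator_subset_mul.{u} k
  obtain ⟨r, hr⟩ := exists_commutator_subset_commutatorSet_pow_mul.{u} c
  -- `k ^ r * p` counts S^r·C. The level `N ^ r` is squared because the translates are rechosen
  -- inside G'.
  refine ⟨k ^ r * p, schurBound k * (N ^ r * N ^ r * q * 1), fun G _ S hSX hS hcov hst => ?_⟩
  obtain ⟨R, Z, V, hR, hZ, hRq, hV, hZR, hVZ⟩ := hsub G S hS hcov hst
  obtain ⟨C, hC, hVC⟩ := hp G V Z hZ hVZ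
  have hH : (commutator G : Set G) ⊆ (S ^ r * C) * (Bset (N ^ r) G * (Z : Set G)) := by
    intro h hh
    obtain ⟨w, hw, _, ⟨x, hx, z, hz, rfl⟩, rfl⟩ := hr G V Z C hZ hV hVC hh
    obtain ⟨s, hs, b, hb, rfl⟩ := mul_Bset_pow_subset S N r (Set.pow_subset_pow_left hcov hw)
    refine ⟨s * x, Set.mul_mem_mul hs hx, x⁻¹ * b * x⁻¹⁻¹ * z,
      Set.mul_mem_mul (conj_mem_Bset _ hb) hz, ?_⟩
    simp only
    group
  obtain ⟨T, hTH, hT, hTcov⟩ := exists_subset_covering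
    (C := Bset (N ^ r * N ^ r) G * (Z : Set G))
    (Set.encard_mul_le (Set.encard_pow_le hS r) hC) hH (by
      rintro _ ⟨b, hb, z, hz, rfl⟩ _ ⟨b', hb', z', hz', rfl⟩
      refine ⟨z⁻¹ * (b⁻¹ * b') * z⁻¹⁻¹,
        conj_mem_Bset _ (mul_mem_Bset (inv_mem_Bset hb) hb'), z⁻¹ * z',
        Z.mul_mem (Z.inv_mem hz) hz', ?_⟩
      simp only
      group)
  refine ⟨Subtype.val ⁻¹' T, ?_, ?_⟩
  · rw [← Subtype.val_injective.encard_image]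
    exact (Set.encard_mono (Set.image_preimage_subset _ _)).trans hT
  · intro h _
    obtain ⟨t, ht, b, hb, z, hz, hbz⟩ := hTcov h h.2
    refine ⟨⟨t, hTH ht⟩, ht, ⟨t, hTH ht⟩⁻¹ * h, ?_, mul_inv_cancel_left _ _⟩
    refine mem_Bset_commutator_of_eq_mul (encard_image_commutator_quotient_le hSX hS hcov) hRq hb
      (hZR z hz) _ ?_
    exact hbz.symm

theorem theorem1p1 :
    ∃ f : ℕ → ℕ → ℕ, ∀ (k n : ℕ), 0 < k → 0 < n →
      ∀ (G : Type*) [Group G], CoveringCondition k n G →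
        ∃ B : Subgroup (commutator G), B.Characteristic ∧
          B.FiniteIndex ∧ B.index ≤ f k n ∧
          Finite (commutator B) ∧ Nat.card (commutator B) ≤ f k n := by
  choose r hr using exists_stable_level.{u_1}
  choose t M hcov using exists_covering_of_stable.{u_1}
  choose b hb using exists_characteristic_of_covering.{u_1}
  refine ⟨fun k n => (Finset.range (r (k + 1) (n * n) + 1)).sup
    fun N => b (t (k + 1) N) (M (k + 1) N), ?_⟩
  rintro k n - - G _ ⟨S, hS, hSX⟩
  -- The translates must be by commutators, at the cost of replacing `n` by `n * n`. Adjoining `1`,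
  -- needed to find a stable level, turns `k` into `k + 1`.
  obtain ⟨T, hTX, hTk, hT⟩ := exists_subset_covering (C := Bset (n * n) G) hS hSX
    fun x hx y hy => mul_mem_Bset (inv_mem_Bset hx) hy
  have hT1 : (insert 1 T).encard ≤ (k + 1 : ℕ) := by
    refine (Set.encard_insert_le _ _).trans ?_
    push_cast
    exact add_le_add_left hTk 1
  have hTcov : commutatorSet G ⊆ insert 1 T * Bset (n * n) G := by
    intro x hx
    obtain ⟨s, hs, hsx⟩ := hT x hx
    exact ⟨s, Set.mem_insert_of_mem _ hs, _, hsx, mul_inv_cancel_left _ _⟩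
  obtain ⟨N, hN, T', hT', -, hcov', hst⟩ := hr (k + 1) (n * n) G (commutatorSet G) (insert 1 T)
    (Set.mem_insert _ _) hT1 hTcov
  obtain ⟨Q, hQ, hQcov⟩ := hcov (k + 1) N G T'
    (hT'.trans (Set.insert_subset (one_mem_commutatorSet G) hTX))
    ((Set.encard_mono hT').trans hT1) hcov' hst
  obtain ⟨B, hBc, hBf, hBi, hBfin, hBcard⟩ := hb _ _ (commutator G) Q hQ hQcov
  have hle := Finset.le_sup (f := fun N => b (t (k + 1) N) (M (k + 1) N))
    (Finset.mem_range.2 (Nat.lt_succ_of_le hN))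
  exact ⟨B, hBc, hBf, hBi.trans hle, hBfin, hBcard.trans hle⟩
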